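/- Let $X$ be a Radon plane, i.e. a two-dimensional real normed space with norm $\|\cdot\|$ and unit sphere $S_X=\{x\in X:\|x\|=1\}$ in which Birkhoff orthogonality is symmetric; here $x\perp_B y$ (for $x,y\in X$) means that $\|x+sy\|\ge\|x\|$ for all $s\in\mathbb{R}$. For fixed $t>0$ put $$A_t^B(X)=\sup\left\{\frac{\|x+ty\|+\|tx-y\|}{2}: x,y\in S_X,\ x\perp_B y\right\}.$$ Then, for every fixed $t>0$, the equality $$A_t^B(X)=1+t-\tfrac12\min\{1,t\}$$ holds if and only if $S_X$ is an affine-regular hexagon, i.e. the image of (the boundary of) a regular hexagon in the Euclidean plane under a non-degenerate (bijective) real affine map onto $X$. -/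

import Mathlib

/-- Birkhoff orthogonality `x ⊥_B y` in a real normed space. -/
def BirkhoffOrthogonal {X : Type*} [NormedAddCommGroup X] [NormedSpace ℝ X] (x y : X) : Prop :=
  ∀ s : ℝ, ‖x‖ ≤ ‖x + s • y‖

/-- A Radon plane: a two-dimensional real normed space (automatically complete) in which
Birkhoff orthogonality is symmetric. -/
def IsRadonPlane (X : Type*) [NormedAddCommGroup X] [NormedSpace ℝ X] : Prop :=
  Module.finrank ℝ X = 2 ∧ ∀ x y : X, BirkhoffOrthogonal x y → BirkhoffOrthogonal y x

/-- The set of values `(‖x + t y‖ + ‖t x - y‖) / 2` for unit vectors `x ⊥_B y`. -/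
def birkhoffMeans (X : Type*) [NormedAddCommGroup X] [NormedSpace ℝ X] (t : ℝ) : Set ℝ :=
  {r | ∃ x y : X, x ∈ Metric.sphere (0 : X) 1 ∧ y ∈ Metric.sphere (0 : X) 1 ∧
    BirkhoffOrthogonal x y ∧ r = (‖x + t • y‖ + ‖t • x - y‖) / 2}

/-- The constant `A_t^B(X)`. -/
noncomputable def birkhoffConstant (X : Type*) [NormedAddCommGroup X] [NormedSpace ℝ X]
    (t : ℝ) : ℝ :=
  sSup (birkhoffMeans X t)

/-- The set whose supremum defines `A_t^B(X)` is bounded above. -/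
theorem bddAbove_birkhoffMeans (X : Type*) [NormedAddCommGroup X] [NormedSpace ℝ X] (t : ℝ) :
    BddAbove (birkhoffMeans X t) := by
  refine ⟨1 + |t|, ?_⟩
  rintro r ⟨x, y, hx, hy, -, rfl⟩
  rw [mem_sphere_zero_iff_norm] at hx hy
  have h1 := norm_add_le x (t • y)
  have h2 := norm_sub_le (t • x) y
  rw [norm_smul, Real.norm_eq_abs, hx, hy] at h1 h2
  linarith

/-- The regular hexagon in the Euclidean plane `ℂ` whose vertices are, in cyclic order,
the sixth roots of unity. -/
noncomputable def regularHexagon : Polygon ℂ 6 :=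
  ⟨fun k => Complex.exp (2 * Real.pi * Complex.I * ((k : ℕ) : ℂ) / 6)⟩

/-- An affine-regular hexagon (as a closed curve, the union of its six sides): the image of a
regular hexagon under a non-degenerate real affine transformation. All regular hexagons are
similar, so it suffices to use one of them. -/
def IsAffineRegularHexagon {X : Type*} [NormedAddCommGroup X] [NormedSpace ℝ X]
    (S : Set X) : Prop :=
  ∃ f : ℂ ≃ᵃ[ℝ] X, S = f '' regularHexagon.boundary ℝ

open Filter Topology Set

/-! For unit `x ⊥ y`, scale the area form `ω` so that `ω x y = 1`. In a Radon plane the norm is then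
its own dual: `‖u‖` is the maximum of `ω u v` over unit `v` (`IsRadonPlane.area_duality`). Indeed,
symmetry of orthogonality gives the norm and its dual the same relative subgradients along the line
`x + ℝ y`, so their ratio is constant there.

Testing `x + y` and `x - y` against maximising vectors `v`, `w`, the inequality `ω w v ≤ 1` yields
`‖x + y‖ + ‖x - y‖ ≤ 3`. Equality produces unit vectors `p`, `q`, `p + q` with `ω p q = 1`, and
duality then forces the unit sphere to be the hexagon with vertices `±p`, `±(p + q)`, `±q`.

The triangle inequality reduces every `t > 0` to `t = 1`, compactness makes the supremum attained,
and in a hexagon the pair `p`, `q` attains the bound. -/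

/-! ### Subgradients of convex functions on the line -/

/-- A subgradient at `s > x` lies between the slope over `[x, s]` and the slope over `[s, 2s - x]`.
Both tend to `f'`, the second being twice the slope over `[x, 2s - x]` minus the slope over `[x,
s]`. -/
theorem tendsto_subgradient_right {f c : ℝ → ℝ} {f' x : ℝ}
    (hc : ∀ s s', f s + c s * (s' - s) ≤ f s') (hf : HasDerivWithinAt f f' (Ioi x) x) :
    Tendsto c (𝓝[>] x) (𝓝 f') := by
  have h1 : Tendsto (slope f x) (𝓝[>] x) (𝓝 f') :=
    (hasDerivWithinAt_iff_tendsto_slope' self_notMem_Ioi).mp hf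
  have h2 : Tendsto (fun s : ℝ => 2 * s - x) (𝓝[>] x) (𝓝[>] x) := by
    refine tendsto_nhdsWithin_iff.mpr ⟨?_, ?_⟩
    · have : Continuous fun s : ℝ => 2 * s - x := by fun_prop
      have h := this.tendsto x
      rw [show 2 * x - x = x by ring] at h
      exact h.mono_left nhdsWithin_le_nhds
    · filter_upwards [self_mem_nhdsWithin] with s hs
      simp only [mem_Ioi] at hs ⊢
      linarith
  have h3 : Tendsto (fun s => 2 * slope f x (2 * s - x) - slope f x s) (𝓝[>] x) (𝓝 f') := by
    have h := ((h1.comp h2).const_mul 2).sub h1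
    rw [show 2 * f' - f' = f' by ring] at h
    exact h
  refine tendsto_of_tendsto_of_tendsto_of_le_of_le' h1 h3 ?_ ?_
  · filter_upwards [self_mem_nhdsWithin] with s hs
    simp only [mem_Ioi] at hs
    rw [slope_def_field, div_le_iff₀ (by linarith)]
    linarith [hc s x]
  · filter_upwards [self_mem_nhdsWithin] with s hs
    simp only [mem_Ioi] at hs
    have h0 : (0 : ℝ) < s - x := by linarith
    have h := hc s (2 * s - x)
    have h4 : 2 * slope f x (2 * s - x) - slope f x s = (f (2 * s - x) - f s) / (s - x) := by
      rw [slope_def_field, slope_def_field, show 2 * s - x - x = 2 * (s - x) by ring]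
      field_simp
      ring
    rw [h4, le_div_iff₀ h0]
    linarith

theorem convexOn_of_subgradient {f c : ℝ → ℝ} (hc : ∀ s s', f s + c s * (s' - s) ≤ f s') :
    ConvexOn ℝ univ f := by
  refine ⟨convex_univ, fun x _ y _ a b ha hb hab => ?_⟩
  simp only [smul_eq_mul]
  set m := a * x + b * y with hm
  have h1 := mul_le_mul_of_nonneg_left (hc m x) ha
  have h2 := mul_le_mul_of_nonneg_left (hc m y) hb
  have h3 : a * (f m + c m * (x - m)) + b * (f m + c m * (y - m)) = f m := by
    have : a * (x - m) + b * (y - m) = 0 := by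
      rw [show a * (x - m) + b * (y - m) = (a * x + b * y) - (a + b) * m by ring, hab, ← hm]
      ring
    linear_combination f m * hab + c m * this
  linarith

/-- Two positive functions with a common relative subgradient are proportional. -/
theorem div_eq_div_of_relative_subgradient {f g κ : ℝ → ℝ} (hf0 : ∀ s, 0 < f s)
    (hg0 : ∀ s, 0 < g s) (hf : ∀ s s', f s + f s * κ s * (s' - s) ≤ f s')
    (hg : ∀ s s', g s + g s * κ s * (s' - s) ≤ g s') (s t : ℝ) :
    f s / g s = f t / g t := by
  have hcf := convexOn_of_subgradient (c := fun s => f s * κ s) hf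
  have hcg := convexOn_of_subgradient (c := fun s => g s * κ s) hg
  have hf1 : Continuous f := continuousOn_univ.mp (hcf.continuousOn isOpen_univ)
  have hg1 : Continuous g := continuousOn_univ.mp (hcg.continuousOn isOpen_univ)
  have hcont : Continuous fun s => f s / g s := hf1.div hg1 fun s => (hg0 s).ne'
  -- `κ` tends from the right to both `f' / f` and `g' / g` at `x`, so these agree and the quotient
  -- has zero right derivative.
  have hderiv : ∀ x, HasDerivWithinAt (fun s => f s / g s) 0 (Ici x) x := by
    intro x
    have hx : x ∈ interior (univ : Set ℝ) := by simp
    have hf2 := hcf.hasDerivWithinAt_rightDeriv_of_mem_interior hx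
    have hg2 := hcg.hasDerivWithinAt_rightDeriv_of_mem_interior hx
    set f' := derivWithin f (Ioi x) x
    set g' := derivWithin g (Ioi x) x
    have tf := (tendsto_subgradient_right (c := fun s => f s * κ s) hf hf2).div
      ((hf1.tendsto x).mono_left nhdsWithin_le_nhds) (hf0 x).ne'
    have tg := (tendsto_subgradient_right (c := fun s => g s * κ s) hg hg2).div
      ((hg1.tendsto x).mono_left nhdsWithin_le_nhds) (hg0 x).ne'
    have e1 : ((fun s => f s * κ s) / fun s => f s) = κ := by
      funext s
      simp [mul_div_cancel_left₀ _ (hf0 s).ne']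
    have e2 : ((fun s => g s * κ s) / fun s => g s) = κ := by
      funext s
      simp [mul_div_cancel_left₀ _ (hg0 s).ne']
    have hκ : f' / f x = g' / g x := tendsto_nhds_unique (e1 ▸ tf) (e2 ▸ tg)
    rw [div_eq_div_iff (hf0 x).ne' (hg0 x).ne'] at hκ
    have h := (hf2.div hg2 (hg0 x).ne').Ici_of_Ioi
    rwa [hκ, mul_comm (f x), sub_self, zero_div] at h
  have key : ∀ a b, a ≤ b → f b / g b = f a / g a := fun a b hab =>
    constant_of_has_deriv_right_zero hcont.continuousOn (fun x _ => hderiv x) b ⟨hab, le_rfl⟩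
  rcases le_total s t with h | h
  · exact (key s t h).symm
  · exact key t s h

/-! ### Area forms and the duality of Radon planes -/

section

variable {X : Type*} [NormedAddCommGroup X] [NormedSpace ℝ X]

theorem BirkhoffOrthogonal.abs_mul_norm_le {u v : X} (h : BirkhoffOrthogonal u v) (a b : ℝ) :
    |a| * ‖u‖ ≤ ‖a • u + b • v‖ := by
  rcases eq_or_ne a 0 with rfl | ha
  · simp
  · have : a • u + b • v = a • (u + (b / a) • v) := by
      rw [smul_add, smul_smul, mul_div_cancel₀ _ ha]
    rw [this, norm_smul, Real.norm_eq_abs]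
    exact mul_le_mul_of_nonneg_left (h _) (abs_nonneg a)

/-- A nondegenerate alternating form on a plane, with its expansion formula. -/
structure IsAreaForm (ω : X →ₗ[ℝ] X →ₗ[ℝ] ℝ) : Prop where
  self : ∀ u, ω u u = 0
  expand : ∀ u v w, ω u v • w = ω w v • u + ω u w • v

theorem IsAreaForm.swap {ω : X →ₗ[ℝ] X →ₗ[ℝ] ℝ} (hω : IsAreaForm ω) (u v : X) :
    ω u v = -ω v u := by
  have h := hω.self (u + v)
  simp only [map_add, LinearMap.add_apply, hω.self] at h
  linarith

theorem BirkhoffOrthogonal.exists_areaForm {x y : X} (hX : Module.finrank ℝ X = 2)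
    (hx : ‖x‖ = 1) (hy : ‖y‖ = 1) (h : BirkhoffOrthogonal x y) :
    ∃ ω : X →ₗ[ℝ] X →ₗ[ℝ] ℝ, IsAreaForm ω ∧ ω x y = 1 := by
  have hli : LinearIndependent ℝ ![x, y] := by
    rw [LinearIndependent.pair_iff]
    intro a b hab
    have h1 := h.abs_mul_norm_le a b
    rw [hab, hx, norm_zero, mul_one] at h1
    have ha : a = 0 := abs_eq_zero.mp (le_antisymm h1 (abs_nonneg a))
    have hy0 : y ≠ 0 := by
      rintro rfl
      simp at hy
    rw [ha, zero_smul, zero_add, smul_eq_zero] at hab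
    exact ⟨ha, hab.resolve_right hy0⟩
  let b := basisOfLinearIndependentOfCardEqFinrank hli (by simp [hX])
  have hb0 : b 0 = x := by simp [b]
  have hb1 : b 1 = y := by simp [b]
  have hrepr : ∀ w, w = b.coord 0 w • x + b.coord 1 w • y := by
    intro w
    have := b.sum_repr w
    rw [Fin.sum_univ_two, hb0, hb1] at this
    exact this.symm
  refine ⟨(b.coord 0).smulRight (b.coord 1) - (b.coord 1).smulRight (b.coord 0), ⟨?_, ?_⟩, ?_⟩
  · intro u
    simp only [LinearMap.sub_apply, LinearMap.smulRight_apply, LinearMap.smul_apply, smul_eq_mul]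
    ring
  · intro u v w
    have hu := hrepr u
    have hv := hrepr v
    have hw := hrepr w
    simp only [LinearMap.sub_apply, LinearMap.smulRight_apply, LinearMap.smul_apply, smul_eq_mul]
    generalize b.coord 0 u = u0 at *
    generalize b.coord 1 u = u1 at *
    generalize b.coord 0 v = v0 at *
    generalize b.coord 1 v = v1 at *
    generalize b.coord 0 w = w0 at *
    generalize b.coord 1 w = w1 at *
    rw [hu, hv, hw]
    module
  · simp [← hb0, ← hb1]

theorem exists_norm_eq_one_forall_le [FiniteDimensional ℝ X] [Nontrivial X] (ℓ : X →ₗ[ℝ] ℝ) :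
    ∃ v, ‖v‖ = 1 ∧ ∀ w, ℓ w ≤ ℓ v * ‖w‖ := by
  have : ProperSpace X := FiniteDimensional.proper ℝ X
  have hne : (Metric.sphere (0 : X) 1).Nonempty := NormedSpace.sphere_nonempty.mpr zero_le_one
  obtain ⟨v, hv, hmax⟩ := (isCompact_sphere (0 : X) 1).exists_isMaxOn hne
    (LinearMap.continuous_of_finiteDimensional ℓ).continuousOn
  refine ⟨v, mem_sphere_zero_iff_norm.mp hv, fun w => ?_⟩
  rcases eq_or_ne w 0 with rfl | hw
  · simp
  · have hw' : 0 < ‖w‖ := norm_pos_iff.mpr hw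
    have h : ℓ (‖w‖⁻¹ • w) ≤ ℓ v := hmax (by simp [norm_smul, hw'.ne'])
    rw [map_smul, smul_eq_mul, inv_mul_le_iff₀ hw'] at h
    linarith

/-- In a Radon plane the norm coincides with the norm dual to it under a suitable area form. -/
theorem IsRadonPlane.area_duality (hX : IsRadonPlane X) {ω : X →ₗ[ℝ] X →ₗ[ℝ] ℝ}
    (hω : IsAreaForm ω) {x y : X} (hx : ‖x‖ = 1) (hy : ‖y‖ = 1) (hxy : BirkhoffOrthogonal x y)
    (h1 : ω x y = 1) (u : X) :
    (∀ w, ω u w ≤ ‖u‖ * ‖w‖) ∧ ∃ v, ‖v‖ = 1 ∧ ω u v = ‖u‖ := by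
  have hfin : FiniteDimensional ℝ X := FiniteDimensional.of_finrank_eq_succ hX.1
  have hnt : Nontrivial X := ⟨x, 0, by rintro rfl; simp at hx⟩
  choose V hV1 hV using fun z => exists_norm_eq_one_forall_le (ω z)
  have hx_le : ∀ w, ω x w ≤ ‖w‖ := by
    intro w
    have h := (hX.2 x y hxy).abs_mul_norm_le (ω x w) (ω w y)
    rw [hy, mul_one, add_comm, ← hω.expand, h1, one_smul] at h
    exact (le_abs_self _).trans h
  have hy_le : ∀ w, ω y w ≤ ‖w‖ := by
    intro w
    have h := hxy.abs_mul_norm_le (ω w y) (ω x w)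
    rw [hx, mul_one, ← hω.expand, h1, one_smul, hω.swap, abs_neg] at h
    exact (le_abs_self _).trans h
  have hzy : ∀ s : ℝ, ω (x + s • y) y = 1 := by
    intro s
    simp [h1, hω.self]
  have hpos : ∀ s : ℝ, 0 < ω (x + s • y) (V (x + s • y)) := by
    intro s
    have h := hV (x + s • y) y
    rw [hzy, hy] at h
    linarith
  have hzpos : ∀ s : ℝ, 0 < ‖x + s • y‖ := by
    intro s
    rw [norm_pos_iff]
    intro h
    have := hzy s
    simp [h] at this
  -- Compare the dual norm `f` with the norm `g` on the line `x + ℝ y`; the maximiser `V` supplies a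
  -- subgradient of `f` directly.
  have hratio := div_eq_div_of_relative_subgradient (f := fun s => ω (x + s • y) (V (x + s • y)))
    (g := fun s => ‖x + s • y‖)
    (κ := fun s => ω y (V (x + s • y)) / ω (x + s • y) (V (x + s • y))) hpos hzpos
    (by
      intro s s'
      rw [mul_div_cancel₀ _ (hpos s).ne']
      have h := hV (x + s' • y) (V (x + s • y))
      rw [hV1, mul_one] at h
      refine le_trans (le_of_eq ?_) h
      simp only [map_add, map_smul, LinearMap.add_apply, LinearMap.smul_apply, smul_eq_mul]
      ring)
    (by
      intro s s'
      have hs := hpos s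
      -- Adding multiples of `z = x + s • y` to `V z` leaves `ω z` unchanged, so maximality gives `V
      -- z ⊥ z`. The Radon symmetry turns this into `z ⊥ V z`, which says that `ω · (V z)`, suitably
      -- scaled, supports the norm at `z`.
      have horth : BirkhoffOrthogonal (V (x + s • y)) (x + s • y) := by
        intro r
        rw [hV1]
        have h := hV (x + s • y) (V (x + s • y) + r • (x + s • y))
        rw [map_add, map_smul, hω.self, smul_zero, add_zero] at h
        exact le_of_mul_le_mul_left (by linarith) hs
      have h := (hX.2 _ _ horth).abs_mul_norm_le (ω (x + s' • y) (V (x + s • y)))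
        (ω (x + s • y) (x + s' • y))
      rw [← hω.expand, norm_smul, Real.norm_eq_abs, abs_of_pos hs] at h
      have h' := (mul_le_mul_of_nonneg_right (le_abs_self _) (norm_nonneg _)).trans h
      have e : ω (x + s' • y) (V (x + s • y)) =
          ω (x + s • y) (V (x + s • y)) + (s' - s) * ω y (V (x + s • y)) := by
        simp only [map_add, map_smul, LinearMap.add_apply, LinearMap.smul_apply, smul_eq_mul]
        ring
      rw [e] at h'
      refine le_of_mul_le_mul_left (le_trans (le_of_eq ?_) h') hs
      field_simp)
  have hφx : ω x (V x) = 1 := by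
    refine le_antisymm ?_ ?_
    · have h := hx_le (V x)
      rwa [hV1] at h
    · have h := hV x y
      rwa [h1, hy, mul_one] at h
  have hline : ∀ s : ℝ, ω (x + s • y) (V (x + s • y)) = ‖x + s • y‖ := by
    intro s
    have h := hratio s 0
    simp only [zero_smul, add_zero, hφx, hx, div_one] at h
    rwa [div_eq_one_iff_eq (hzpos s).ne'] at h
  have hsmul : ∀ (c : ℝ) (z : X), ((∀ w, ω z w ≤ ‖z‖ * ‖w‖) ∧ ∃ v, ‖v‖ = 1 ∧ ω z v = ‖z‖) →
      ((∀ w, ω (c • z) w ≤ ‖c • z‖ * ‖w‖) ∧ ∃ v, ‖v‖ = 1 ∧ ω (c • z) v = ‖c • z‖) := by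
    rintro c z ⟨hz, v, hv, hzv⟩
    refine ⟨fun w => ?_, ?_⟩
    · have h := hz (c • w)
      rw [norm_smul] at h ⊢
      simp only [map_smul, LinearMap.smul_apply, smul_eq_mul] at h ⊢
      linarith
    · rcases le_total 0 c with hc | hc
      · refine ⟨v, hv, ?_⟩
        rw [map_smul, LinearMap.smul_apply, hzv, norm_smul, Real.norm_of_nonneg hc, smul_eq_mul]
      · refine ⟨-v, by rwa [norm_neg], ?_⟩
        rw [map_smul, LinearMap.smul_apply, map_neg, hzv, norm_smul, Real.norm_of_nonpos hc,
          smul_eq_mul]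
        ring
  have hu := hω.expand x y u
  rw [h1, one_smul] at hu
  -- Every vector is a multiple of a point of `x + ℝ y`, except those parallel to `y`.
  rcases eq_or_ne (ω u y) 0 with h0 | h0
  · rw [h0, zero_smul, zero_add] at hu
    rw [hu]
    refine hsmul _ _ ⟨fun w => by simpa [hy] using hy_le w, -x, by rwa [norm_neg], ?_⟩
    rw [map_neg, ← hω.swap, h1, hy]
  · have hu' : u = ω u y • (x + (ω x u / ω u y) • y) := by
      rw [smul_add, smul_smul, mul_div_cancel₀ _ h0]
      exact hu
    rw [hu']
    refine hsmul _ _ ⟨fun w => ?_, V _, hV1 _, hline _⟩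
    rw [← hline]
    exact hV _ w

/-! ### Affine-regular hexagons -/

/-- The boundary of the hexagon with vertices `±p`, `±(p + q)`, `±q`. -/
def hexagonEdges (p q : X) : Set X :=
  {z | ∃ s ∈ Icc (0 : ℝ) 1, ∃ ε : ℝ, (ε = 1 ∨ ε = -1) ∧
    (z = ε • (p + s • q) ∨ z = ε • (s • p + q) ∨ z = ε • (s • q - (1 - s) • p))}

theorem neg_mem_hexagonEdges {p q z : X} (h : z ∈ hexagonEdges p q) : -z ∈ hexagonEdges p q := by
  obtain ⟨s, hs, ε, hε, h⟩ := h
  refine ⟨s, hs, -ε, ?_, ?_⟩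
  · rcases hε with rfl | rfl <;> simp
  · simpa only [neg_smul, neg_inj] using h

/-- Pairing `a • p + b • q` with `q`, `p` and `p + q` bounds its norm below by `|a|`, `|b|` and `|a
- b|`; the triangle inequality gives the matching upper bound in each sector between adjacent
vertices. -/
theorem sphere_eq_hexagonEdges {ω : X →ₗ[ℝ] X →ₗ[ℝ] ℝ} (hω : IsAreaForm ω)
    (hle : ∀ u v, ω u v ≤ ‖u‖ * ‖v‖) {p q : X} (hp : ‖p‖ = 1) (hq : ‖q‖ = 1)
    (hpq : ‖p + q‖ = 1) (h1 : ω p q = 1) : Metric.sphere (0 : X) 1 = hexagonEdges p q := by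
  have habs : ∀ u v, |ω u v| ≤ ‖u‖ * ‖v‖ := by
    intro u v
    refine abs_le'.mpr ⟨hle u v, ?_⟩
    have h := hle u (-v)
    rwa [map_neg, norm_neg] at h
  have hqp : ω q p = -1 := by rw [hω.swap, h1]
  have hb : ∀ a b : ℝ, |a| ≤ ‖a • p + b • q‖ ∧ |b| ≤ ‖a • p + b • q‖ ∧
      |a - b| ≤ ‖a • p + b • q‖ := by
    intro a b
    have e1 := habs (a • p + b • q) q
    have e2 := habs p (a • p + b • q)
    have e3 := habs (a • p + b • q) (p + q)
    simp only [map_add, map_smul, LinearMap.add_apply, LinearMap.smul_apply, smul_eq_mul, hω.self,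
      h1, hqp, hp, hq, hpq, mul_one, one_mul, mul_zero, add_zero, zero_add] at e1 e2 e3
    rw [show b * -1 + a = a - b by ring] at e3
    exact ⟨e1, e2, e3⟩
  ext z
  rw [mem_sphere_zero_iff_norm]
  constructor
  · intro hz
    obtain ⟨a, b, rfl⟩ : ∃ a b : ℝ, z = a • p + b • q :=
      ⟨ω z q, ω p z, by rw [← hω.expand, h1, one_smul]⟩
    have main : ∀ a b : ℝ, ‖a • p + b • q‖ = 1 → 0 ≤ b → a • p + b • q ∈ hexagonEdges p q := by
      intro a b hz hb0
      obtain ⟨ha1, hb1, hc1⟩ := hb a b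
      rw [hz] at ha1 hb1 hc1
      rw [abs_le] at ha1 hb1 hc1
      rcases le_total a 0 with ha | ha
      · have h : ‖a • p + b • q‖ ≤ b - a := by
          have h := norm_add_le (a • p) (b • q)
          rw [norm_smul, norm_smul, hp, hq, Real.norm_of_nonpos ha, Real.norm_of_nonneg hb0] at h
          linarith
        rw [hz] at h
        have hab : a = -(1 - b) := by linarith
        refine ⟨b, ⟨hb0, hb1.2⟩, 1, Or.inl rfl, Or.inr (Or.inr ?_)⟩
        rw [hab]
        module
      · rcases le_total a b with hab | hab
        · have h : ‖a • p + b • q‖ ≤ b := by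
            have h := norm_add_le (a • (p + q)) ((b - a) • q)
            rw [norm_smul, norm_smul, hpq, hq, Real.norm_of_nonneg ha,
              Real.norm_of_nonneg (sub_nonneg.mpr hab),
              show a • (p + q) + (b - a) • q = a • p + b • q by module] at h
            linarith
          rw [hz] at h
          have hb2 : b = 1 := le_antisymm hb1.2 h
          refine ⟨a, ⟨ha, ha1.2⟩, 1, Or.inl rfl, Or.inr (Or.inl ?_)⟩
          rw [hb2]
          module
        · have h : ‖a • p + b • q‖ ≤ a := by
            have h := norm_add_le (b • (p + q)) ((a - b) • p)
            rw [norm_smul, norm_smul, hpq, hp, Real.norm_of_nonneg hb0,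
              Real.norm_of_nonneg (sub_nonneg.mpr hab),
              show b • (p + q) + (a - b) • p = a • p + b • q by module] at h
            linarith
          rw [hz] at h
          have ha2 : a = 1 := le_antisymm ha1.2 h
          refine ⟨b, ⟨hb0, hb1.2⟩, 1, Or.inl rfl, Or.inl ?_⟩
          rw [ha2]
          module
    rcases le_total 0 b with h0 | h0
    · exact main a b hz h0
    · have e : a • p + b • q = -((-a) • p + (-b) • q) := by module
      rw [e] at hz ⊢
      rw [norm_neg] at hz
      exact neg_mem_hexagonEdges (main _ _ hz (by linarith))
  · rintro ⟨s, ⟨hs0, hs1⟩, ε, hε, h⟩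
    have hε1 : ‖ε‖ = 1 := by rcases hε with rfl | rfl <;> simp
    have hs1' : 0 ≤ 1 - s := by linarith
    have hconv : ∀ u v : X, ‖u‖ = 1 → ‖v‖ = 1 → ‖s • u + (1 - s) • v‖ ≤ 1 := by
      intro u v hu hv
      have h := norm_add_le (s • u) ((1 - s) • v)
      rw [norm_smul, norm_smul, hu, hv, Real.norm_of_nonneg hs0, Real.norm_of_nonneg hs1'] at h
      linarith
    rcases h with rfl | rfl | rfl <;> rw [norm_smul, hε1, one_mul]
    · refine le_antisymm ?_ ?_
      · have h := hconv (p + q) p hpq hp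
        rwa [show s • (p + q) + (1 - s) • p = p + s • q by module] at h
      · simpa using (hb 1 s).1
    · refine le_antisymm ?_ ?_
      · have h := hconv (p + q) q hpq hq
        rwa [show s • (p + q) + (1 - s) • q = s • p + q by module] at h
      · simpa using (hb s 1).2.1
    · refine le_antisymm ?_ ?_
      · have h := hconv q (-p) hq (by rwa [norm_neg])
        rwa [show s • q + (1 - s) • -p = s • q - (1 - s) • p by module] at h
      · have h := (hb (-(1 - s)) s).2.2
        rw [show -(1 - s) - s = -1 by ring, abs_neg, abs_one] at h
        rwa [show s • q - (1 - s) • p = -(1 - s) • p + s • q by module]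

/-- The second vertex of `regularHexagon`. -/
noncomputable def sixthRoot : ℂ := ⟨1 / 2, √3 / 2⟩

theorem exp_eq_sixthRoot : Complex.exp (2 * Real.pi * Complex.I / 6) = sixthRoot := by
  have e : (2 * Real.pi * Complex.I / 6 : ℂ) = ((Real.pi / 3 : ℝ) : ℂ) * Complex.I := by
    push_cast
    ring
  rw [e]
  apply Complex.ext
  · rw [Complex.exp_ofReal_mul_I_re, Real.cos_pi_div_three]
    rfl
  · rw [Complex.exp_ofReal_mul_I_im, Real.sin_pi_div_three]
    rfl

theorem sixthRoot_sq : sixthRoot ^ 2 = sixthRoot - 1 := by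
  have h3 : √3 * √3 = 3 := Real.mul_self_sqrt (by norm_num)
  rw [sq]
  apply Complex.ext <;> simp [sixthRoot] <;> linarith

theorem regularHexagon_apply (k : Fin 6) : regularHexagon k = sixthRoot ^ (k : ℕ) := by
  rw [← exp_eq_sixthRoot, ← Complex.exp_nat_mul]
  simp only [regularHexagon]
  congr 1
  ring

theorem image_boundary_regularHexagon (f : ℂ ≃ᵃ[ℝ] X) (h0 : f 0 = 0) :
    f '' regularHexagon.boundary ℝ = hexagonEdges (f 1) (f (sixthRoot - 1)) := by
  set p := f 1 with hp
  set q := f (sixthRoot - 1) with hq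
  have hlin : ∀ z, f z = f.linear z := by
    intro z
    have h := f.map_vadd 0 z
    simpa [h0] using h
  have hv : ∀ a b : ℝ, f ((a : ℂ) + (b : ℂ) * (sixthRoot - 1)) = a • p + b • q := by
    intro a b
    rw [hp, hq, hlin, hlin, hlin, ← map_smul, ← map_smul, ← map_add]
    simp
  have hs2 := sixthRoot_sq
  have v0 : f (regularHexagon 0) = p := by simp [regularHexagon_apply, hp]
  have v1 : f (regularHexagon 1) = p + q := by
    have h := hv 1 1
    rw [one_smul, one_smul] at h
    rw [← h, regularHexagon_apply]
    congr 1
    simp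
  have v2 : f (regularHexagon 2) = q := by
    rw [regularHexagon_apply, hq, ← hs2]
    rfl
  have v3 : f (regularHexagon 3) = -p := by
    have h := hv (-1) 0
    rw [zero_smul, add_zero, neg_one_smul] at h
    rw [← h, regularHexagon_apply]
    congr 1
    change sixthRoot ^ 3 = _
    push_cast
    -- The coefficient, here and for the next two vertices, is the quotient on division by `ζ ^ 2 -
    -- ζ + 1`.
    linear_combination (sixthRoot + 1) * hs2
  have v4 : f (regularHexagon 4) = -p - q := by
    have h := hv (-1) (-1)
    rw [neg_one_smul, neg_one_smul, ← sub_eq_add_neg] at h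
    rw [← h, regularHexagon_apply]
    congr 1
    change sixthRoot ^ 4 = _
    push_cast
    linear_combination (sixthRoot ^ 2 + sixthRoot) * hs2
  have v5 : f (regularHexagon 5) = -q := by
    have h := hv 0 (-1)
    rw [zero_smul, zero_add, neg_one_smul] at h
    rw [← h, regularHexagon_apply]
    congr 1
    change sixthRoot ^ 5 = _
    push_cast
    linear_combination (sixthRoot ^ 3 + sixthRoot ^ 2 - 1) * hs2
  have hb : f '' regularHexagon.boundary ℝ =
      ⋃ i, affineSegment ℝ (f (regularHexagon i)) (f (regularHexagon (finRotate 6 i))) := by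
    rw [Polygon.boundary, image_iUnion]
    refine iUnion_congr fun i => ?_
    exact affineSegment_image (f : ℂ →ᵃ[ℝ] X) _ _
  rw [hb]
  ext z
  simp only [mem_iUnion, affineSegment, mem_image, AffineMap.lineMap_apply_module]
  constructor
  · rintro ⟨i, s, hs, rfl⟩
    have hs' : 1 - s ∈ Icc (0 : ℝ) 1 := ⟨by linarith [hs.2], by linarith [hs.1]⟩
    fin_cases i
    · change (1 - s) • f (regularHexagon 0) + s • f (regularHexagon 1) ∈ _
      rw [v0, v1]
      exact ⟨s, hs, 1, Or.inl rfl, Or.inl (by module)⟩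
    · change (1 - s) • f (regularHexagon 1) + s • f (regularHexagon 2) ∈ _
      rw [v1, v2]
      exact ⟨1 - s, hs', 1, Or.inl rfl, Or.inr (Or.inl (by module))⟩
    · change (1 - s) • f (regularHexagon 2) + s • f (regularHexagon 3) ∈ _
      rw [v2, v3]
      exact ⟨1 - s, hs', 1, Or.inl rfl, Or.inr (Or.inr (by module))⟩
    · change (1 - s) • f (regularHexagon 3) + s • f (regularHexagon 4) ∈ _
      rw [v3, v4]
      exact ⟨s, hs, -1, Or.inr rfl, Or.inl (by module)⟩
    · change (1 - s) • f (regularHexagon 4) + s • f (regularHexagon 5) ∈ _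
      rw [v4, v5]
      exact ⟨1 - s, hs', -1, Or.inr rfl, Or.inr (Or.inl (by module))⟩
    · change (1 - s) • f (regularHexagon 5) + s • f (regularHexagon 0) ∈ _
      rw [v5, v0]
      exact ⟨1 - s, hs', -1, Or.inr rfl, Or.inr (Or.inr (by module))⟩
  · rintro ⟨s, hs, ε, hε, h⟩
    have hs' : 1 - s ∈ Icc (0 : ℝ) 1 := ⟨by linarith [hs.2], by linarith [hs.1]⟩
    rcases hε with rfl | rfl <;> rcases h with rfl | rfl | rfl
    · refine ⟨0, s, hs, ?_⟩
      change (1 - s) • f (regularHexagon 0) + s • f (regularHexagon 1) = _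
      rw [v0, v1]
      module
    · refine ⟨1, 1 - s, hs', ?_⟩
      change (1 - (1 - s)) • f (regularHexagon 1) + (1 - s) • f (regularHexagon 2) = _
      rw [v1, v2]
      module
    · refine ⟨2, 1 - s, hs', ?_⟩
      change (1 - (1 - s)) • f (regularHexagon 2) + (1 - s) • f (regularHexagon 3) = _
      rw [v2, v3]
      module
    · refine ⟨3, s, hs, ?_⟩
      change (1 - s) • f (regularHexagon 3) + s • f (regularHexagon 4) = _
      rw [v3, v4]
      module
    · refine ⟨4, 1 - s, hs', ?_⟩
      change (1 - (1 - s)) • f (regularHexagon 4) + (1 - s) • f (regularHexagon 5) = _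
      rw [v4, v5]
      module
    · refine ⟨5, 1 - s, hs', ?_⟩
      change (1 - (1 - s)) • f (regularHexagon 5) + (1 - s) • f (regularHexagon 0) = _
      rw [v5, v0]
      module

theorem IsAreaForm.exists_affineEquiv {ω : X →ₗ[ℝ] X →ₗ[ℝ] ℝ} (hω : IsAreaForm ω) {p q : X}
    (h1 : ω p q = 1) : ∃ f : ℂ ≃ᵃ[ℝ] X, f 0 = 0 ∧ f 1 = p ∧ f (sixthRoot - 1) = q := by
  have h3 : √3 ≠ 0 := by positivity
  have hqp : ω q p = -1 := by rw [hω.swap, h1]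
  let e : ℂ ≃ₗ[ℝ] X :=
    { toFun := fun z => (z.re + z.im / √3) • p + (2 * z.im / √3) • q
      invFun := fun w => ⟨ω w q - ω p w / 2, √3 / 2 * ω p w⟩
      map_add' := fun z w => by
        simp only [Complex.add_re, Complex.add_im]
        module
      map_smul' := fun c z => by
        simp only [Complex.real_smul, Complex.re_ofReal_mul, Complex.im_ofReal_mul,
          RingHom.id_apply]
        module
      left_inv := fun z => by
        apply Complex.ext
        · simp [h1, hω.self]
          ring
        · simp [h1, hω.self]
      right_inv := fun w => by
        have hw := hω.expand p q w
        rw [h1, one_smul] at hw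
        simp only
        conv_rhs => rw [hw]
        congr 2 <;> field_simp
        ring }
  refine ⟨e.toAffineEquiv, map_zero e, ?_, ?_⟩
  · change ((1 : ℂ).re + (1 : ℂ).im / √3) • p + (2 * (1 : ℂ).im / √3) • q = p
    simp
  · change ((sixthRoot - 1).re + (sixthRoot - 1).im / √3) • p +
      (2 * (sixthRoot - 1).im / √3) • q = q
    have a1 : (sixthRoot - 1).re + (sixthRoot - 1).im / √3 = 0 := by
      simp only [sixthRoot, Complex.sub_re, Complex.sub_im, Complex.one_re, Complex.one_im]
      field_simp
      norm_num
    have a2 : 2 * (sixthRoot - 1).im / √3 = 1 := by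
      simp only [sixthRoot, Complex.sub_im, Complex.one_im]
      field_simp
      norm_num
    rw [a1, a2, zero_smul, one_smul, zero_add]

/-- The sphere would be symmetric about `f 0`. If `f 0 ≠ 0`, reflecting the unit vector opposite to
`f 0` gives a vector of norm `2 * ‖f 0‖ + 1 > 1`. -/
theorem AffineEquiv.map_zero_eq_zero_of_sphere_eq {f : ℂ ≃ᵃ[ℝ] X}
    (hf : Metric.sphere (0 : X) 1 = f '' regularHexagon.boundary ℝ) : f 0 = 0 := by
  by_contra hc
  have hH := image_boundary_regularHexagon (AffineEquiv.refl ℝ ℂ) rfl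
  have hneg : ∀ z ∈ regularHexagon.boundary ℝ, -z ∈ regularHexagon.boundary ℝ := by
    simp only [AffineEquiv.coe_refl, image_id] at hH
    intro z hz
    rw [hH] at hz ⊢
    exact neg_mem_hexagonEdges hz
  have hlin : ∀ z, f z = f.linear z + f 0 := by
    intro z
    simpa using f.map_vadd 0 z
  have hshift : ∀ z ∈ Metric.sphere (0 : X) 1, 2 • f 0 - z ∈ Metric.sphere (0 : X) 1 := by
    intro z hz
    rw [hf] at hz ⊢
    obtain ⟨w, hw, rfl⟩ := hz
    refine ⟨-w, hneg w hw, ?_⟩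
    rw [hlin w, hlin (-w), map_neg]
    module
  have hpos : 0 < ‖f 0‖ := norm_pos_iff.mpr hc
  have h := hshift (-(‖f 0‖⁻¹ • f 0)) (by simp [norm_smul, hpos.ne'])
  rw [mem_sphere_zero_iff_norm,
    show 2 • f 0 - -(‖f 0‖⁻¹ • f 0) = (2 + ‖f 0‖⁻¹) • f 0 by module, norm_smul,
    Real.norm_of_nonneg (by positivity), add_mul, inv_mul_cancel₀ hpos.ne'] at h
  linarith

/-! ### The sharp bound and its equality case -/

/-- On a Radon plane, `‖x + y‖ + ‖x - y‖ ≤ 3` for orthogonal unit vectors, and equality yields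
unit vectors `p`, `q`, `p + q` spanning area one. -/
theorem IsRadonPlane.norm_add_add_norm_sub {x y : X} {ω : X →ₗ[ℝ] X →ₗ[ℝ] ℝ}
    (hX : IsRadonPlane X) (hω : IsAreaForm ω) (hx : ‖x‖ = 1) (hy : ‖y‖ = 1)
    (hxy : BirkhoffOrthogonal x y) (h1 : ω x y = 1) :
    ‖x + y‖ + ‖x - y‖ ≤ 3 ∧ (‖x + y‖ + ‖x - y‖ = 3 →
      ∃ p q, ‖p‖ = 1 ∧ ‖q‖ = 1 ∧ ‖p + q‖ = 1 ∧ ω p q = 1) := by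
  have hD := hX.area_duality hω hx hy hxy h1
  have hyx : ω y x = -1 := by rw [hω.swap, h1]
  obtain ⟨v, hv, hav⟩ := (hD (x + y)).2
  obtain ⟨w, hw, hbw⟩ := (hD (x - y)).2
  have ev := hω.expand x y v
  have ew := hω.expand x y w
  rw [h1, one_smul] at ev ew
  have hv1 := (hD v).1 (-y)
  have hv2 := (hD x).1 v
  have hw1 := (hD w).1 y
  have hw2 := (hD x).1 w
  have hwv := (hD w).1 v
  generalize ω v y = c' at *
  -- With this sign `v = -c x + d y` and `w = e x + f y`, so the two norms are `c + d` and `e + f`,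
  -- and `ω w v = c f + d e`.
  obtain ⟨c, rfl⟩ : ∃ c, c' = -c := ⟨-c', by ring⟩
  generalize ω x v = d at *
  generalize ω w y = e at *
  generalize ω x w = f at *
  subst ev ew
  simp only [map_add, map_sub, map_neg, map_smul, LinearMap.add_apply, LinearMap.sub_apply,
    LinearMap.smul_apply, smul_eq_mul, hω.self, h1, hyx, hx, hy, hv, hw, norm_neg] at hav hbw hv1 hv2 hw1 hw2 hwv
  have hc1 : c ≤ 1 := by linarith
  have hd1 : d ≤ 1 := by linarith
  have he1 : e ≤ 1 := by linarith
  have hf1 : f ≤ 1 := by linarith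
  -- The two products sum to `2 - (c + d + e + f) + ω w v ≤ 3 - (c + d + e + f)`; equality in the
  -- bound makes both vanish.
  have hcf : 0 ≤ (1 - c) * (1 - f) := mul_nonneg (by linarith) (by linarith)
  have hde : 0 ≤ (1 - d) * (1 - e) := mul_nonneg (by linarith) (by linarith)
  refine ⟨by linarith, fun h3 => ?_⟩
  have hcf0 : (1 - c) * (1 - f) = 0 := by linarith
  have hde0 : (1 - d) * (1 - e) = 0 := by linarith
  have hsum : c + d + e + f = 3 := by linarith
  rcases mul_eq_zero.mp hcf0 with h | h <;> rcases mul_eq_zero.mp hde0 with h' | h'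
  · obtain rfl : c = 1 := by linarith
    obtain rfl : d = 1 := by linarith
    refine ⟨x, _, hx, hv, ?_, ?_⟩
    · rwa [show x + (-(1 : ℝ) • x + (1 : ℝ) • y) = y by module]
    · simp [h1, hω.self]
  · obtain rfl : c = 1 := by linarith
    obtain rfl : e = 1 := by linarith
    obtain rfl : f = 1 - d := by linarith
    refine ⟨_, _, hw, hv, ?_, ?_⟩
    · rwa [show (1 : ℝ) • x + (1 - d) • y + (-(1 : ℝ) • x + d • y) = y by module]
    · simp [h1, hyx, hω.self]
  · obtain rfl : f = 1 := by linarith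
    obtain rfl : d = 1 := by linarith
    obtain rfl : e = 1 - c := by linarith
    refine ⟨x, _, hx, hv, ?_, ?_⟩
    · rwa [show x + (-c • x + (1 : ℝ) • y) = (1 - c) • x + (1 : ℝ) • y by module]
    · simp [h1, hω.self]
  · obtain rfl : f = 1 := by linarith
    obtain rfl : e = 1 := by linarith
    refine ⟨x, y, hx, hy, ?_, h1⟩
    rwa [one_smul, one_smul] at hw

/-- Split off `min 1 t` times `x + y` and `x - y`; what remains is a multiple of a unit vector. -/
theorem norm_add_smul_add_norm_smul_sub_le {x y : X} (hx : ‖x‖ = 1) (hy : ‖y‖ = 1) {t : ℝ}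
    (ht : 0 < t) : ‖x + t • y‖ + ‖t • x - y‖ ≤
      2 * (1 + t) + min 1 t * (‖x + y‖ + ‖x - y‖ - 4) := by
  rcases le_total t 1 with h | h
  · rw [min_eq_right h]
    have a1 := norm_add_le (t • (x + y)) ((1 - t) • x)
    have a2 := norm_sub_le (t • (x - y)) ((1 - t) • y)
    rw [show t • (x + y) + (1 - t) • x = x + t • y by module, norm_smul, norm_smul, hx,
      Real.norm_of_nonneg ht.le, Real.norm_of_nonneg (sub_nonneg.mpr h)] at a1
    rw [show t • (x - y) - (1 - t) • y = t • x - y by module, norm_smul, norm_smul, hy,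
      Real.norm_of_nonneg ht.le, Real.norm_of_nonneg (sub_nonneg.mpr h)] at a2
    linarith
  · rw [min_eq_left h]
    have a1 := norm_add_le (x + y) ((t - 1) • y)
    have a2 := norm_add_le (x - y) ((t - 1) • x)
    rw [show x + y + (t - 1) • y = x + t • y by module, norm_smul, hy,
      Real.norm_of_nonneg (sub_nonneg.mpr h)] at a1
    rw [show x - y + (t - 1) • x = t • x - y by module, norm_smul, hx,
      Real.norm_of_nonneg (sub_nonneg.mpr h)] at a2
    linarith

theorem IsRadonPlane.le_of_mem_birkhoffMeans (hX : IsRadonPlane X) {t : ℝ} (ht : 0 < t) {r : ℝ}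
    (hr : r ∈ birkhoffMeans X t) : r ≤ 1 + t - 1 / 2 * min 1 t := by
  obtain ⟨x, y, hx, hy, hxy, rfl⟩ := hr
  rw [mem_sphere_zero_iff_norm] at hx hy
  obtain ⟨ω, hω, h1⟩ := hxy.exists_areaForm hX.1 hx hy
  have h3 := (hX.norm_add_add_norm_sub hω hx hy hxy h1).1
  have h := norm_add_smul_add_norm_smul_sub_le hx hy ht
  have hm : 0 < min 1 t := lt_min one_pos ht
  have := mul_le_mul_of_nonneg_left h3 hm.le
  linarith

theorem isCompact_birkhoffMeans [FiniteDimensional ℝ X] (t : ℝ) :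
    IsCompact (birkhoffMeans X t) := by
  have : ProperSpace X := FiniteDimensional.proper ℝ X
  have hS := isCompact_sphere (0 : X) 1
  have hcl : IsClosed {z : X × X | BirkhoffOrthogonal z.1 z.2} := by
    simp only [BirkhoffOrthogonal, ofPred_forall]
    exact isClosed_iInter fun s => isClosed_le (by fun_prop) (by fun_prop)
  have hK := ((hS.prod hS).inter_right hcl).image
    (f := fun z : X × X => (‖z.1 + t • z.2‖ + ‖t • z.1 - z.2‖) / 2) (by fun_prop)
  convert hK using 1
  ext r
  constructor
  · rintro ⟨x, y, hx, hy, hxy, rfl⟩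
    exact ⟨(x, y), ⟨⟨hx, hy⟩, hxy⟩, rfl⟩
  · rintro ⟨⟨x, y⟩, ⟨⟨hx, hy⟩, hxy⟩, rfl⟩
    exact ⟨x, y, hx, hy, hxy, rfl⟩

/-- The pair `p`, `q` works: `t • p - q` points at the edge between `p` and `-q`, so its norm is `1
+ t`, while `‖p + t • q‖ = max 1 t`. -/
theorem mem_birkhoffMeans_of_sphere_eq_hexagonEdges {p q : X}
    (hS : Metric.sphere (0 : X) 1 = hexagonEdges p q) {t : ℝ} (ht : 0 < t) :
    1 + t - 1 / 2 * min 1 t ∈ birkhoffMeans X t := by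
  have n1 : ∀ s ∈ Icc (0 : ℝ) 1, ‖p + s • q‖ = 1 := fun s hs => by
    rw [← mem_sphere_zero_iff_norm, hS]
    exact ⟨s, hs, 1, Or.inl rfl, Or.inl (one_smul _ _).symm⟩
  have n2 : ∀ s ∈ Icc (0 : ℝ) 1, ‖s • p + q‖ = 1 := fun s hs => by
    rw [← mem_sphere_zero_iff_norm, hS]
    exact ⟨s, hs, 1, Or.inl rfl, Or.inr (Or.inl (one_smul _ _).symm)⟩
  have n3 : ∀ s ∈ Icc (0 : ℝ) 1, ‖s • q - (1 - s) • p‖ = 1 := fun s hs => by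
    rw [← mem_sphere_zero_iff_norm, hS]
    exact ⟨s, hs, 1, Or.inl rfl, Or.inr (Or.inr (one_smul _ _).symm)⟩
  have hp : ‖p‖ = 1 := by simpa using n1 0 (by simp)
  have hq : ‖q‖ = 1 := by simpa using n2 0 (by simp)
  have hpq : ‖p + q‖ = 1 := by simpa using n1 1 (by simp)
  refine ⟨p, q, mem_sphere_zero_iff_norm.mpr hp, mem_sphere_zero_iff_norm.mpr hq, fun r => ?_, ?_⟩
  · rw [hp]
    rcases le_total r 0 with hr | hr
    · have h := norm_add_le (p + r • q) ((-r) • (p + q))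
      rw [show p + r • q + (-r) • (p + q) = (1 - r) • p by module, norm_smul, norm_smul, hp, hpq,
        Real.norm_of_nonneg (by linarith), Real.norm_of_nonneg (by linarith)] at h
      linarith
    · rcases le_total r 1 with hr1 | hr1
      · exact (n1 r ⟨hr, hr1⟩).ge
      · have h := norm_add_le (p + r • q) ((r - 1) • p)
        rw [show p + r • q + (r - 1) • p = r • (p + q) by module, norm_smul, norm_smul, hp, hpq,
          Real.norm_of_nonneg hr, Real.norm_of_nonneg (by linarith)] at h
        linarith
  · have h1t : 0 < 1 + t := by linarith
    have hsub : ‖t • p - q‖ = 1 + t := by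
      have h := n3 (1 / (1 + t)) ⟨by positivity, (div_le_one h1t).mpr (by linarith)⟩
      have e : t • p - q = (-(1 + t)) • ((1 / (1 + t)) • q - (1 - 1 / (1 + t)) • p) := by
        rw [smul_sub, smul_smul, smul_smul]
        have e1 : -(1 + t) * (1 / (1 + t)) = -1 := by field_simp
        have e2 : -(1 + t) * (1 - 1 / (1 + t)) = -t := by
          field_simp
          ring
        rw [e1, e2]
        module
      rw [e, norm_smul, h, norm_neg, Real.norm_of_nonneg h1t.le, mul_one]
    rw [hsub]
    rcases le_total t 1 with h | h
    · rw [min_eq_right h, n1 t ⟨ht.le, h⟩]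
      ring
    · have hn := n2 (1 / t) ⟨by positivity, (div_le_one ht).mpr h⟩
      have e : p + t • q = t • ((1 / t) • p + q) := by
        rw [smul_add, smul_smul, mul_one_div_cancel ht.ne', one_smul]
      rw [min_eq_left h, e, norm_smul, hn, Real.norm_of_nonneg ht.le]
      ring

end

theorem mainTheorem1 {X : Type*} [NormedAddCommGroup X] [NormedSpace ℝ X]
    (hX : IsRadonPlane X) (t : ℝ) (ht : 0 < t) :
    birkhoffConstant X t = 1 + t - 1 / 2 * min 1 t ↔
      IsAffineRegularHexagon (Metric.sphere (0 : X) 1) := by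
  have hfin : FiniteDimensional ℝ X := FiniteDimensional.of_finrank_eq_succ hX.1
  have hm : 0 < min 1 t := lt_min one_pos ht
  constructor
  · intro h
    -- The supremum of the empty set is `0` by convention, whereas the assumed value is positive.
    have hne : (birkhoffMeans X t).Nonempty := by
      rw [nonempty_iff_ne_empty]
      intro h0
      rw [birkhoffConstant, h0, Real.sSup_empty] at h
      linarith [min_le_left 1 t]
    have hmem := (isCompact_birkhoffMeans (X := X) t).sSup_mem hne
    rw [← birkhoffConstant, h] at hmem
    obtain ⟨x, y, hx, hy, hxy, hr⟩ := hmem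
    rw [mem_sphere_zero_iff_norm] at hx hy
    obtain ⟨ω, hω, h1⟩ := hxy.exists_areaForm hX.1 hx hy
    obtain ⟨h3, heq⟩ := hX.norm_add_add_norm_sub hω hx hy hxy h1
    have hle := norm_add_smul_add_norm_smul_sub_le hx hy ht
    have hge : 3 ≤ ‖x + y‖ + ‖x - y‖ := le_of_mul_le_mul_left (by linarith) hm
    obtain ⟨p, q, hp, hq, hpq, hω1⟩ := heq (le_antisymm h3 hge)
    obtain ⟨f, h0, rfl, rfl⟩ := hω.exists_affineEquiv hω1
    refine ⟨f, ?_⟩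
    rw [image_boundary_regularHexagon f h0]
    exact sphere_eq_hexagonEdges hω (fun u => (hX.area_duality hω hx hy hxy h1 u).1) hp hq hpq hω1
  · rintro ⟨f, hf⟩
    have h0 := AffineEquiv.map_zero_eq_zero_of_sphere_eq hf
    rw [image_boundary_regularHexagon f h0] at hf
    have hmem := mem_birkhoffMeans_of_sphere_eq_hexagonEdges hf ht
    refine le_antisymm (csSup_le ⟨_, hmem⟩ fun r hr => hX.le_of_mem_birkhoffMeans ht hr) ?_
    exact le_csSup (bddAbove_birkhoffMeans X t) hmem
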